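/- Let $k\ge 2$ and let $G$ be an $n$-vertex graph in the family $\mathcal{S}_{n,k}$: $G$ is a starlike tree consisting of a central vertex $u$ adjacent to exactly one end of each of $h\ge 3$ disjoint nonempty paths $P_{a_1},\dots,P_{a_h}$ ($P_a$ being the path on $a$ vertices), where $a_i$ is even for $1\le i\le h-1$, $a_1=a_2=k$, and $a_h<n/2$ is odd. For vectors $y,z\in\{0,1\}^k$, a graph $G^*$ on $\{1,\dots,k\}$ and a graph $\breve G$ with root $u$, let $G(G^*,\breve G,y)$ be the graph formed by two disjoint copies of $G^*$ and one copy of $\breve G$, in which $u$ is joined to both copies of the vertex $i$ of $G^*$ exactly when $y_i=1$; the operation $\mathcal{E}_z$ adds to it an edge between the two copies of the vertex $i$ whenever $z_i=1$. View $G\in\mathcal{S}_{n,k}$ as $G(P_k,\breve G,e_k)$, where $P_k$ is labelled $1,\dots,k$ along the path and $e_k=(0,\dots,0,1)^T$ (the two copies of $P_k$ being two branches of $G$ with $k$ vertices), and let $e_1=(1,0,\dots,0)^T$. Thus $\mathcal{E}_{e_1}(G)$ is obtained from $G$ by joining the leaves of two branches with $k$ vertices. For a finite graph $F$ let $\sigma^F$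 be the number, counted with multiplicity, of eigenvalues of the Laplacian matrix $L(F)=D(F)-A(F)$ that are greater than or equal to the average degree of $F$. Then $$\sigma^{G}=\sigma^{\mathcal{E}_{e_1}(G)}=\frac n2 ,$$ for every way of viewing $G$ as $G(P_k,\breve G,e_k)$. -/

import Mathlib

open scoped Classical in
/-- The Laplacian spectrum of a finite simple graph: the multiset of eigenvalues of `L = D - A`,
listed with multiplicity. -/
noncomputable def lspect {V : Type*} [Fintype V] (G : SimpleGraph V) : Multiset ℝ :=
  (G.lapMatrix ℝ).charpoly.roots

open scoped Classical in
/-- The average degree of a finite simple graph. -/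
noncomputable def avgDegree {V : Type*} [Fintype V] (G : SimpleGraph V) : ℝ :=
  (∑ v, (G.degree v : ℝ)) / Fintype.card V

open scoped Classical in
/-- The number (with multiplicity) of Laplacian eigenvalues that are at least the average degree. -/
noncomputable def sigmaG {V : Type*} [Fintype V] (G : SimpleGraph V) : ℕ :=
  (lspect G).countP (fun μ => avgDegree G ≤ μ)

/-- The graph `G(G*, B, y)`: two disjoint copies of `Gs` (on `Fin k`) and one copy of `B`, where
the root `u` of `B` is joined to both copies of the vertex `i` of `Gs` exactly when `y i` holds. -/
def wGraph {k : ℕ} {U : Type*} (Gs : SimpleGraph (Fin k)) (B : SimpleGraph U) (u : U)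
    (y : Fin k → Bool) : SimpleGraph (Fin k ⊕ Fin k ⊕ U) where
  Adj p q := match p, q with
    | .inl i, .inl j => Gs.Adj i j
    | .inr (.inl i), .inr (.inl j) => Gs.Adj i j
    | .inr (.inr s), .inr (.inr t) => B.Adj s t
    | .inl i, .inr (.inr t) => y i = true ∧ t = u
    | .inr (.inr t), .inl i => y i = true ∧ t = u
    | .inr (.inl i), .inr (.inr t) => y i = true ∧ t = u
    | .inr (.inr t), .inr (.inl i) => y i = true ∧ t = u
    | .inl _, .inr (.inl _) => False
    | .inr (.inl _), .inl _ => False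
  symm := ⟨by
    rintro (i | i | s) (j | j | t) h
    all_goals first | exact h | exact SimpleGraph.Adj.symm h⟩
  loopless := ⟨by
    rintro (i | i | s) h
    all_goals exact SimpleGraph.irrefl _ h⟩

/-- A graph `G` with a chosen presentation `φ` as `G(G*, B, y)`: the operation `E_z` inserts an
edge between the two copies of the vertex `i` of `G*` whenever `z i` holds. -/
def operationE {k : ℕ} {U V : Type*} {Gs : SimpleGraph (Fin k)} {B : SimpleGraph U} {u : U}
    {y : Fin k → Bool} {G : SimpleGraph V} (φ : wGraph Gs B u y ≃g G) (z : Fin k → Bool) :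
    SimpleGraph V :=
  G ⊔ SimpleGraph.fromRel
    (fun p q => ∃ i : Fin k, z i = true ∧ p = φ (.inl i) ∧ q = φ (.inr (.inl i)))

/-- The canonical vector `e_i ∈ {0,1}^k`; coordinates are numbered `1, …, k`. -/
def canonVec (k i : ℕ) : Fin k → Bool := fun j => decide (j.val + 1 = i)

/-- The graph made of a central vertex `none` adjacent to one of the ends (the last vertex) of
each of the paths `P_{a i}`; the vertices of the `i`-th path are `some ⟨i, 0⟩, some ⟨i, 1⟩, …`. -/
def starlikeGraph {h : ℕ} (a : Fin h → ℕ) : SimpleGraph (Option (Σ i : Fin h, Fin (a i))) where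
  Adj p q := match p, q with
    | none, none => False
    | none, some t => t.2.val + 1 = a t.1
    | some s, none => s.2.val + 1 = a s.1
    | some s, some t => s.1 = t.1 ∧ (s.2.val + 1 = t.2.val ∨ t.2.val + 1 = s.2.val)
  symm := ⟨by
    rintro (_ | s) (_ | t) h
    · exact h
    · exact h
    · exact h
    · exact ⟨h.1.symm, h.2.symm⟩⟩
  loopless := ⟨by
    rintro (_ | s) h
    · exact h
    · have := h.2
      omega⟩

/-- The family `S_{n,k}`: `n`-vertex starlike trees whose central vertex is adjacent to one of the
ends of `h = m + 3` (nonempty) paths `P_{a_1}, …, P_{a_h}`, where `a_1 = a_2 = k ≥ 2`, all the `a_i`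
with `i < h` are even, and `a_h < n / 2` is odd. -/
def FamilyS (n k : ℕ) {V : Type*} (G : SimpleGraph V) : Prop :=
  Nat.card V = n ∧ 2 ≤ k ∧ ∃ (m : ℕ) (a : Fin (m + 3) → ℕ),
    a 0 = k ∧ a 1 = k ∧ (∀ i, 0 < a i) ∧ (∀ i, i ≠ Fin.last (m + 2) → Even (a i)) ∧
    Odd (a (Fin.last (m + 2))) ∧ (a (Fin.last (m + 2)) : ℝ) < n / 2 ∧
    Nonempty (starlikeGraph a ≃g G)

/-- Every member of `S_{n,k}` can be viewed as a graph `G(P_k, B, e_k)`, the two copies of `P_k`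
being two branches of the starlike tree. -/
theorem FamilyS.exists_presentation {n k : ℕ} {V : Type*} {G : SimpleGraph V}
    (hG : FamilyS n k G) : ∃ (U : Type) (B : SimpleGraph U) (u : U),
      Nonempty (wGraph (SimpleGraph.pathGraph k) B u (canonVec k k) ≃g G) := by
  classical
  obtain ⟨-, -, m, a, h0, h1, -, -, -, -, ⟨ψ⟩⟩ := hG
  let W := Option (Σ i : Fin (m + 3), Fin (a i))
  have h01 : (0 : Fin (m + 3)) ≠ 1 := by simp
  let U : Type := {p : W // ∀ s, p = some s → s.1 ≠ 0 ∧ s.1 ≠ 1}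
  let f : Fin k ⊕ Fin k ⊕ U → W := fun p => match p with
    | .inl i => some ⟨0, Fin.cast h0.symm i⟩
    | .inr (.inl i) => some ⟨1, Fin.cast h1.symm i⟩
    | .inr (.inr s) => s.1
  have hf : Function.Bijective f := by
    constructor
    · rintro (i | i | ⟨_ | s, hs⟩) (j | j | ⟨_ | t, ht⟩) h
      all_goals simp only [f, reduceCtorEq] at h ⊢
      · have h' := Option.some.inj h
        simp only [Sigma.mk.injEq, true_and, heq_eq_eq, Fin.cast_inj] at h'
        rw [h']
      · exact h01 (congrArg Sigma.fst (Option.some.inj h))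
      · exact (ht _ h.symm).1 rfl
      · exact h01 (congrArg Sigma.fst (Option.some.inj h)).symm
      · have h' := Option.some.inj h
        simp only [Sigma.mk.injEq, true_and, heq_eq_eq, Fin.cast_inj] at h'
        rw [h']
      · exact ((ht _ h.symm).2 rfl).elim
      · exact (hs _ h).1 rfl
      · exact ((hs _ h).2 rfl).elim
      · cases h
        rfl
    · rintro (_ | ⟨s, j⟩)
      · exact ⟨.inr (.inr ⟨none, by simp⟩), rfl⟩
      · by_cases e0 : s = 0
        · subst e0
          exact ⟨.inl (Fin.cast h0 j), rfl⟩
        · by_cases e1 : s = 1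
          · subst e1
            exact ⟨.inr (.inl (Fin.cast h1 j)), rfl⟩
          · exact ⟨.inr (.inr ⟨some ⟨s, j⟩, by rintro t ⟨⟩; exact ⟨e0, e1⟩⟩), rfl⟩
  refine ⟨U, (starlikeGraph a).comap Subtype.val, ⟨none, by simp⟩, ⟨RelIso.trans
    ⟨Equiv.ofBijective f hf, ?_⟩ ψ⟩⟩
  rintro (i | i | ⟨_ | s, hs⟩) (j | j | ⟨_ | t, ht⟩)
  all_goals simp [f, wGraph, starlikeGraph, canonVec, SimpleGraph.pathGraph_adj]
  · rw [h0]
  · exact iff_of_false (fun h => (ht _ rfl).1 h.1.symm) (fun h => by simpa using congrArg Subtype.val h.2)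
  · rw [h1]
  · exact iff_of_false (fun h => (ht _ rfl).2 h.1.symm) (fun h => by simpa using congrArg Subtype.val h.2)
  · rw [h0]
  · rw [h1]
  · exact iff_of_false (fun h => (hs _ rfl).1 h.1) (fun h => by simpa using congrArg Subtype.val h.2)
  · exact iff_of_false (fun h => (hs _ rfl).2 h.1) (fun h => by simpa using congrArg Subtype.val h.2)

/-!
The number of Laplacian eigenvalues smaller than `α` is the negative index of inertia of the form
`xᵀ (L - α) x`, hence monotone in `α`. A tree in `S_{n,k}` has a perfect matching, and the vectors
with opposite values at the ends of each matching edge form a space of dimension `n / 2` on which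
`L ≥ 2`; so at most `n / 2` eigenvalues are smaller than `2`. Conversely, on the vectors which
vanish at the centre the form splits into contributions of the branches. A branch with `a` vertices
carries a negative space of dimension `⌈a / 2⌉` for `α = 2 - 2 / n`, the average degree of the tree,
provided that `a < n`, and `a < n / 2` if `a` is odd. These dimensions add up to `n / 2`.

Joining the leaves of two equal branches raises the average degree to `2` and keeps the matching. It
changes the form only on the vectors which are antisymmetric under the exchange of the two branches.
On these the index at `α = 2` is at most `k / 2` before the operation, because `P_k` has a perfect
matching, and at least `k / 2` afterwards, so the index of the whole form does not drop.
-/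

section Signature

open QuadraticForm QuadraticMap Module

variable {M M₁ M₂ X : Type*} [AddCommGroup M] [Module ℝ M] [AddCommGroup M₁] [Module ℝ M₁]
  [AddCommGroup M₂] [Module ℝ M₂] [AddCommGroup X] [Module ℝ X]
  [FiniteDimensional ℝ M₁] [FiniteDimensional ℝ M₂]

theorem finrank_le_sigNeg [FiniteDimensional ℝ M] {Q : QuadraticForm ℝ M} (T : X →ₗ[ℝ] M)
    (hT : ∀ x ≠ 0, Q (T x) < 0) : finrank ℝ X ≤ sigNeg Q := by
  have hinj : Function.Injective T := by
    rw [← LinearMap.ker_eq_bot, LinearMap.ker_eq_bot']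
    intro x hx
    by_contra hne
    simpa [hx] using hT x hne
  rw [← LinearMap.finrank_range_of_inj hinj]
  refine le_sigNeg_of_negDef Q ?_
  rintro ⟨_, x, rfl⟩ hx
  have hx₀ : x ≠ 0 := by rintro rfl; simp at hx
  simpa using hT x hx₀

theorem sigNeg_add_finrank_le [FiniteDimensional ℝ M] {Q : QuadraticForm ℝ M} (T : X →ₗ[ℝ] M)
    (hinj : Function.Injective T) (hT : ∀ x, 0 ≤ Q (T x)) :
    sigNeg Q + finrank ℝ X ≤ finrank ℝ M := by
  rw [← LinearMap.finrank_range_of_inj hinj, ← sigPos_neg]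
  refine sigPos_add_finrank_le_of_nonpos ?_
  rintro _ ⟨x, rfl⟩
  simpa using hT x

theorem sigNeg_le_of_forall_neg [FiniteDimensional ℝ M] {Q Q' : QuadraticForm ℝ M}
    (h : ∀ x, Q' x < 0 → Q x < 0) : sigNeg Q' ≤ sigNeg Q := by
  obtain ⟨W, hW, hneg⟩ := exists_finrank_eq_sigNeg_and_negDef Q'
  rw [← hW]
  refine finrank_le_sigNeg W.subtype fun x hx ↦ h _ ?_
  simpa using hneg x hx

theorem sigNeg_prod (Q₁ : QuadraticForm ℝ M₁) (Q₂ : QuadraticForm ℝ M₂) :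
    sigNeg (Q₁.prod Q₂) = sigNeg Q₁ + sigNeg Q₂ := by
  obtain ⟨w₁, ⟨e₁⟩⟩ := Q₁.equivalent_weightedSumSquares
  obtain ⟨w₂, ⟨e₂⟩⟩ := Q₂.equivalent_weightedSumSquares
  have hsum : (Q₁.prod Q₂).Equivalent (weightedSumSquares ℝ (Sum.elim w₁ w₂)) := by
    refine ⟨⟨(e₁.toLinearEquiv.prodCongr e₂.toLinearEquiv).trans
      (LinearEquiv.sumArrowLequivProdArrow _ _ ℝ ℝ).symm, fun x ↦ ?_⟩⟩
    simp [weightedSumSquares_apply, ← e₁.map_app, ← e₂.map_app, -IsometryEquiv.map_app]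
  rw [sigNeg_of_equiv_weightedSumSquares hsum, sigNeg_of_equiv_weightedSumSquares ⟨e₁⟩,
    sigNeg_of_equiv_weightedSumSquares ⟨e₂⟩]
  simp only [Set.ncard_eq_toFinset_card', Set.toFinset_ofPred, Finset.card_filter,
    Fintype.sum_sum_type, Sum.elim_inl, Sum.elim_inr]
  congr!

theorem sigNeg_eq_add_of_map_neg_right {Q : QuadraticForm ℝ M} (f : (M₁ × M₂) ≃ₗ[ℝ] M)
    (hf : ∀ a b, Q (f (a, -b)) = Q (f (a, b))) :
    sigNeg Q = sigNeg (Q.comp (f.toLinearMap ∘ₗ LinearMap.inl ℝ M₁ M₂)) +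
      sigNeg (Q.comp (f.toLinearMap ∘ₗ LinearMap.inr ℝ M₁ M₂)) := by
  rw [← sigNeg_prod]
  refine (QuadraticMap.Equivalent.sigNeg_eq ⟨⟨f, ?_⟩⟩).symm
  rintro ⟨a, b⟩
  have hadd : Q (f (a, b)) = Q (f (a, 0)) + Q (f (0, b)) + polar Q (f (a, 0)) (f (0, b)) := by
    rw [← QuadraticMap.map_add Q, ← _root_.map_add f, Prod.mk_add_mk, add_zero, zero_add]
  have hsub : Q (f (a, -b)) = Q (f (a, 0)) + Q (f (0, b)) - polar Q (f (a, 0)) (f (0, b)) := by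
    rw [← Q.map_neg (f (0, b)), sub_eq_add_neg, ← polar_neg_right,
      ← QuadraticMap.map_add Q, ← _root_.map_neg f, ← _root_.map_add f]
    simp
  change Q (f (a, b)) = Q (f (a, 0)) + Q (f (0, b))
  linarith [hf a b]

theorem sigNeg_le_sigNeg_of_map_neg_right {Q Q' : QuadraticForm ℝ M} (f : (M₁ × M₂) ≃ₗ[ℝ] M)
    (hf : ∀ a b, Q (f (a, -b)) = Q (f (a, b))) (hf' : ∀ a b, Q' (f (a, -b)) = Q' (f (a, b)))
    (hleft : ∀ a, Q (f (a, 0)) = Q' (f (a, 0)))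
    (hright : sigNeg (Q.comp (f.toLinearMap ∘ₗ LinearMap.inr ℝ M₁ M₂)) ≤
      sigNeg (Q'.comp (f.toLinearMap ∘ₗ LinearMap.inr ℝ M₁ M₂))) :
    sigNeg Q ≤ sigNeg Q' := by
  have hcomp : Q.comp (f.toLinearMap ∘ₗ LinearMap.inl ℝ M₁ M₂) =
      Q'.comp (f.toLinearMap ∘ₗ LinearMap.inl ℝ M₁ M₂) := QuadraticMap.ext hleft
  rw [sigNeg_eq_add_of_map_neg_right f hf, sigNeg_eq_add_of_map_neg_right f hf', hcomp]
  exact Nat.add_le_add_left hright _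

end Signature

section Spectrum

open QuadraticForm QuadraticMap Matrix

variable {ι : Type*} [Fintype ι] [DecidableEq ι]

theorem toQuadraticForm'_equivalent_weightedSumSquares {A : Matrix ι ι ℝ} {w : ι → ℝ}
    (b : OrthonormalBasis ι ℝ (EuclideanSpace ℝ ι))
    (hA : ∀ i, A *ᵥ (b i).ofLp = w i • (b i).ofLp) :
    A.toQuadraticForm'.Equivalent (weightedSumSquares ℝ w) := by
  have hdot (i j : ι) : (b i).ofLp ⬝ᵥ (b j).ofLp = if i = j then 1 else 0 := by
    simpa [EuclideanSpace.inner_eq_star_dotProduct, eq_comm] using b.inner_eq_ite j i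
  refine QuadraticMap.Equivalent.symm ⟨⟨(WithLp.linearEquiv 2 ℝ (ι → ℝ)).symm.trans
    (b.repr.symm.toLinearEquiv.trans (WithLp.linearEquiv 2 ℝ (ι → ℝ))), fun c ↦ ?_⟩⟩
  simpa [toQuadraticForm', toLinearMap₂'_apply', weightedSumSquares_apply, ← b.sum_repr_symm,
    hA, hdot] using Finset.sum_congr rfl fun i _ ↦
      (by ring : c i * (c i * w i) = w i * (c i * c i))

theorem sigNeg_toQuadraticForm'_sub_smul_one {A : Matrix ι ι ℝ} (hA : A.IsHermitian) (α : ℝ) :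
    sigNeg (A - α • 1).toQuadraticForm' = A.charpoly.roots.countP (· < α) := by
  have heigen (i : ι) : (A - α • 1) *ᵥ (hA.eigenvectorBasis i).ofLp =
      (hA.eigenvalues i - α) • (hA.eigenvectorBasis i).ofLp := by
    rw [sub_mulVec, smul_mulVec, one_mulVec, hA.mulVec_eigenvectorBasis, sub_smul]
  rw [sigNeg_of_equiv_weightedSumSquares
      (toQuadraticForm'_equivalent_weightedSumSquares hA.eigenvectorBasis heigen),
    hA.roots_charpoly_eq_eigenvalues, Multiset.countP_map]
  simp [Set.ncard_eq_toFinset_card', Finset.card_def, -Set.toFinset_card]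

end Spectrum

section LaplacianForm

open Matrix SimpleGraph Function

variable {V W ι : Type*}

/-- The contribution of an edge to `xᵀ L x`. -/
def sqDiff (x : V → ℝ) : Sym2 V → ℝ :=
  Sym2.lift ⟨fun i j ↦ (x i - x j) ^ 2, fun i j ↦ sub_sq_comm (x i) (x j)⟩

theorem sqDiff_mk (x : V → ℝ) (i j : V) : sqDiff x s(i, j) = (x i - x j) ^ 2 := rfl

theorem sqDiff_nonneg (x : V → ℝ) (e : Sym2 V) : 0 ≤ sqDiff x e := by
  induction e with | h i j => exact sq_nonneg _

variable [Fintype V] [Fintype W] [Fintype ι]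

open scoped Classical in
/-- The quadratic form `x ↦ xᵀ (L(G) - α) x`. Its negative index of inertia `sigNeg` is the number
of Laplacian eigenvalues of `G` smaller than `α`. -/
noncomputable def lapForm (G : SimpleGraph V) (α : ℝ) : QuadraticForm ℝ (V → ℝ) :=
  (G.lapMatrix ℝ - α • 1).toQuadraticForm'

theorem sigmaG_add_sigNeg_lapForm (G : SimpleGraph V) :
    sigmaG G + sigNeg (lapForm G (avgDegree G)) = Fintype.card V := by
  classical
  have hL : (G.lapMatrix ℝ).IsHermitian := (G.posSemidef_lapMatrix ℝ).isHermitian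
  have hcard : (G.lapMatrix ℝ).charpoly.roots.card = Fintype.card V := by
    simp [hL.roots_charpoly_eq_eigenvalues]
  rw [lapForm, sigNeg_toQuadraticForm'_sub_smul_one hL, sigmaG, lspect, ← hcard,
    Multiset.card_eq_countP_add_countP (fun μ ↦ avgDegree G ≤ μ)]
  simp only [not_le]

open scoped Classical in
theorem lapForm_apply (G : SimpleGraph V) (α : ℝ) (x : V → ℝ) :
    lapForm G α x =
      (∑ i, ∑ j, if G.Adj i j then (x i - x j) ^ 2 else 0) / 2 - α * ∑ i, x i ^ 2 := by
  have h := G.lapMatrix_toLinearMap₂' (R := ℝ) x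
  have hnorm : x ⬝ᵥ x = ∑ i, x i ^ 2 := by simp only [dotProduct, sq]
  rw [toLinearMap₂'_apply'] at h
  simp [lapForm, toQuadraticForm', toLinearMap₂'_apply', h, hnorm]

theorem lapForm_anti (G : SimpleGraph V) {α β : ℝ} (h : α ≤ β) (x : V → ℝ) :
    lapForm G β x ≤ lapForm G α x := by
  classical
  rw [lapForm_apply, lapForm_apply]
  gcongr

theorem sigNeg_lapForm_mono (G : SimpleGraph V) : Monotone fun α ↦ sigNeg (lapForm G α) :=
  fun _ _ h ↦ sigNeg_le_of_forall_neg fun x hx ↦ (lapForm_anti G h x).trans_lt hx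

theorem lapForm_comp_iso {G : SimpleGraph V} {H : SimpleGraph W} (φ : G ≃g H) (α : ℝ) (x : W → ℝ) :
    lapForm G α (x ∘ φ) = lapForm H α x := by
  classical
  simp only [lapForm_apply, Function.comp_apply, ← φ.map_adj_iff]
  congr 2
  · rw [← φ.toEquiv.sum_comp]
    refine Finset.sum_congr rfl fun i _ ↦ ?_
    exact φ.toEquiv.sum_comp fun j ↦ if H.Adj (φ i) j then (x (φ i) - x j) ^ 2 else 0
  · exact φ.toEquiv.sum_comp fun j ↦ x j ^ 2

theorem sigNeg_lapForm_congr {G : SimpleGraph V} {H : SimpleGraph W} (φ : G ≃g H) (α : ℝ) :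
    sigNeg (lapForm G α) = sigNeg (lapForm H α) :=
  (QuadraticMap.Equivalent.sigNeg_eq
    ⟨⟨LinearEquiv.funCongrLeft ℝ ℝ φ.toEquiv, lapForm_comp_iso φ α⟩⟩).symm

theorem avgDegree_eq (G : SimpleGraph V) : avgDegree G = 2 * G.edgeSet.ncard / Fintype.card V := by
  classical
  rw [avgDegree, ← Nat.cast_sum, G.sum_degrees_eq_twice_card_edges, ← coe_edgeFinset,
    Set.ncard_coe_finset]
  push_cast
  rfl

omit [Fintype V] [Fintype W] in
theorem ncard_edgeSet_congr {G : SimpleGraph V} {H : SimpleGraph W} (φ : G ≃g H) :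
    G.edgeSet.ncard = H.edgeSet.ncard :=
  Nat.card_congr φ.mapEdgeSet

theorem avgDegree_congr {G : SimpleGraph V} {H : SimpleGraph W} (φ : G ≃g H) :
    avgDegree G = avgDegree H := by
  rw [avgDegree_eq, avgDegree_eq, ncard_edgeSet_congr φ, Fintype.card_congr φ.toEquiv]

theorem sigmaG_congr {G : SimpleGraph V} {H : SimpleGraph W} (φ : G ≃g H) :
    sigmaG G = sigmaG H := by
  have hG := sigmaG_add_sigNeg_lapForm G
  have hH := sigmaG_add_sigNeg_lapForm H
  rw [sigNeg_lapForm_congr φ, avgDegree_congr φ, Fintype.card_congr φ.toEquiv] at hG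
  lia

open scoped Classical in
theorem sum_adj_eq_two_mul_sum_edgeFinset (G : SimpleGraph V) (f : Sym2 V → ℝ) :
    (∑ i, ∑ j, if G.Adj i j then f s(i, j) else 0) = 2 * ∑ e ∈ G.edgeFinset, f e := by
  calc (∑ i, ∑ j, if G.Adj i j then f s(i, j) else 0)
      = ∑ d : G.Dart, f d.edge := by
        rw [← Fintype.sum_prod_type', ← Finset.sum_filter]
        refine (Finset.sum_nbij (fun d : G.Dart ↦ d.toProd) (fun d _ ↦ by simp)
          Dart.toProd_injective.injOn (fun d hd ↦ ?_) fun d _ ↦ rfl).symm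
        exact ⟨⟨d, by simpa using hd⟩, by simp⟩
    _ = ∑ e ∈ G.edgeFinset, ∑ d : G.Dart with d.edge = e, f d.edge :=
        (Finset.sum_fiberwise_of_maps_to (fun d _ ↦ mem_edgeFinset.2 d.edge_mem) _).symm
    _ = ∑ e ∈ G.edgeFinset, 2 * f e := by
        refine Finset.sum_congr rfl fun e he ↦ ?_
        rw [Finset.sum_congr rfl fun d hd ↦ congrArg f (Finset.mem_filter.1 hd).2,
          Finset.sum_const, G.dart_edge_fiber_card e (mem_edgeFinset.1 he), nsmul_eq_mul]
        norm_cast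
    _ = 2 * ∑ e ∈ G.edgeFinset, f e := (Finset.mul_sum _ _ _).symm

theorem lapForm_eq_sum_edgeFinset (G : SimpleGraph V) [Fintype G.edgeSet] (α : ℝ) (x : V → ℝ) :
    lapForm G α x = ∑ e ∈ G.edgeFinset, sqDiff x e - α * ∑ i, x i ^ 2 := by
  classical
  have h := sum_adj_eq_two_mul_sum_edgeFinset G (sqDiff x)
  simp only [sqDiff_mk] at h
  rw [lapForm_apply, h, mul_div_cancel_left₀ _ two_ne_zero]
  congr!

theorem lapForm_eq_sum_of_edgeSet_eq_range {G : SimpleGraph V} {p q : ι → V}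
    (hinj : Injective fun i ↦ s(p i, q i)) (hG : G.edgeSet = Set.range fun i ↦ s(p i, q i))
    (α : ℝ) (x : V → ℝ) :
    lapForm G α x = ∑ i, (x (p i) - x (q i)) ^ 2 - α * ∑ v, x v ^ 2 := by
  classical
  have hedges : G.edgeFinset = Finset.univ.image fun i ↦ s(p i, q i) := by
    rw [← Finset.coe_inj, coe_edgeFinset, hG, Finset.coe_image, Finset.coe_univ, Set.image_univ]
  rw [lapForm_eq_sum_edgeFinset, hedges, Finset.sum_image hinj.injOn]
  rfl

theorem lapForm_sup_edge {G : SimpleGraph V} {s t : V} (hadj : ¬G.Adj s t) (hne : s ≠ t)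
    (α : ℝ) (x : V → ℝ) :
    lapForm (G ⊔ edge s t) α x = lapForm G α x + (x s - x t) ^ 2 := by
  classical
  rw [lapForm_eq_sum_edgeFinset, lapForm_eq_sum_edgeFinset, G.edgeFinset_sup_edge hadj hne,
    Finset.sum_cons, sqDiff_mk]
  ring

omit [Fintype V] in
theorem sum_sqDiff_le_sum_edgeFinset {G : SimpleGraph V} [Fintype G.edgeSet] {p q : ι → V}
    (hadj : ∀ i, G.Adj (p i) (q i)) (hinj : Injective fun i ↦ s(p i, q i)) (x : V → ℝ) :
    ∑ i, (x (p i) - x (q i)) ^ 2 ≤ ∑ e ∈ G.edgeFinset, sqDiff x e := by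
  classical
  calc ∑ i, (x (p i) - x (q i)) ^ 2
      = ∑ e ∈ Finset.univ.image fun i ↦ s(p i, q i), sqDiff x e :=
        (Finset.sum_image (f := sqDiff x) hinj.injOn).symm
    _ ≤ ∑ e ∈ G.edgeFinset, sqDiff x e :=
        Finset.sum_le_sum_of_subset_of_nonneg
          (by simpa [Finset.image_subset_iff] using hadj) fun e _ _ ↦ sqDiff_nonneg x e

/-- A vector `x` with opposite values at the ends of each matching edge, and zero elsewhere,
satisfies `xᵀ L x ≥ 2 |x|²`, already by the contribution of the matching edges. -/
theorem sigNeg_lapForm_two_add_card_le {G : SimpleGraph V} {p q : ι → V}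
    (hadj : ∀ i, G.Adj (p i) (q i)) (hinj : Injective (Sum.elim p q)) :
    sigNeg (lapForm G 2) + Fintype.card ι ≤ Fintype.card V := by
  classical
  let T : (ι → ℝ) →ₗ[ℝ] V → ℝ := ExtendByZero.linearMap ℝ (Sum.elim p q) ∘ₗ
    (LinearEquiv.sumArrowLequivProdArrow ι ι ℝ ℝ).symm.toLinearMap ∘ₗ
      LinearMap.id.prod (-LinearMap.id)
  have hT (y : ι → ℝ) (s : ι ⊕ ι) : T y (Sum.elim p q s) = Sum.elim y (-y) s :=
    hinj.extend_apply _ _ _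
  have hTp (y : ι → ℝ) (i : ι) : T y (p i) = y i := hT y (.inl i)
  have hTq (y : ι → ℝ) (i : ι) : T y (q i) = -y i := hT y (.inr i)
  have hTinj : Injective T := fun y z h ↦ funext fun i ↦ by rw [← hTp y, h, hTp z]
  have hnorm (y : ι → ℝ) : ∑ v, T y v ^ 2 = 2 * ∑ i, y i ^ 2 := by
    rw [← Fintype.sum_of_injective _ hinj (fun s ↦ Sum.elim y (-y) s ^ 2) _
      (fun v hv ↦ by simp [T, extend_apply' _ _ _ hv]) fun s ↦ by rw [hT]]
    simp [two_mul]
  have hmatch : Injective fun i ↦ s(p i, q i) := by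
    intro i j h
    rcases Sym2.eq_iff.1 h with ⟨h, -⟩ | ⟨h, -⟩
    · exact Sum.inl_injective (hinj h)
    · exact (Sum.inl_ne_inr (hinj (a₁ := .inl i) (a₂ := .inr j) h)).elim
  simpa using sigNeg_add_finrank_le T hTinj fun y ↦ by
    have hedges := sum_sqDiff_le_sum_edgeFinset hadj hmatch (T y)
    have hfour (i : ι) : (T y (p i) - T y (q i)) ^ 2 = 4 * y i ^ 2 := by
      rw [hTp, hTq]; ring
    simp only [hfour, ← Finset.mul_sum] at hedges
    rw [lapForm_eq_sum_edgeFinset, hnorm]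
    linarith

end LaplacianForm

section Sequences

open Finset (range sum_range_succ)

/-- The contribution of a branch with `a` vertices to the form `xᵀ (L - α) x`. The entries of `x`
on the branch are `x 0, …, x (a - 1)`, listed from the leaf, and `x a` is the entry at the vertex to
which the branch is attached. -/
def branchForm (α : ℝ) (a : ℕ) (x : ℕ → ℝ) : ℝ :=
  ∑ j ∈ range a, (x j - x (j + 1)) ^ 2 - α * ∑ j ∈ range a, x j ^ 2

theorem branchForm_eq (α : ℝ) (a : ℕ) (x : ℕ → ℝ) :
    branchForm α a x = (2 - α) * ∑ j ∈ range a, x j ^ 2 - 2 * ∑ j ∈ range a, x j * x (j + 1)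
      - x 0 ^ 2 + x a ^ 2 := by
  rw [branchForm]
  induction a with
  | zero => simp
  | succ a ih =>
    simp only [sum_range_succ]
    linarith

theorem branchForm_succ_of_eq_zero (α : ℝ) {a : ℕ} {x : ℕ → ℝ} (hx : x (a + 1) = 0) :
    branchForm α (a + 1) x = branchForm α a x + (1 - α) * x a ^ 2 := by
  rw [branchForm, branchForm, sum_range_succ, sum_range_succ, hx]
  ring

theorem sum_range_two_mul (f : ℕ → ℝ) (r : ℕ) :
    ∑ j ∈ range (2 * r), f j = ∑ j ∈ range r, (f (2 * j) + f (2 * j + 1)) := by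
  induction r with
  | zero => simp
  | succ r ih => rw [mul_add_one, sum_range_succ, sum_range_succ, sum_range_succ, ih, add_assoc]

theorem sq_sub_le_mul_sum_sq_sub (y : ℕ → ℝ) {i j r : ℕ} (hij : i ≤ j) (hjr : j ≤ r) :
    (y i - y j) ^ 2 ≤ r * ∑ t ∈ range r, (y t - y (t + 1)) ^ 2 := by
  have htelescope : y i - y j = ∑ t ∈ Finset.Ico i j, (y t - y (t + 1)) := by
    have h := Finset.sum_Ico_sub y hij
    rw [← neg_inj, ← Finset.sum_neg_distrib]
    simpa using h.symm
  calc (y i - y j) ^ 2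
      ≤ (Finset.Ico i j).card * ∑ t ∈ Finset.Ico i j, (y t - y (t + 1)) ^ 2 :=
        htelescope ▸ sq_sum_le_card_mul_sum_sq
    _ ≤ r * ∑ t ∈ range r, (y t - y (t + 1)) ^ 2 := by
        gcongr
        · simpa using by lia
        · exact fun t ht ↦ Finset.mem_range.2 ((Finset.mem_Ico.1 ht).2.trans_le hjr)

theorem add_sq_le_of_sq_le_mul {t d x b : ℝ} (ht : 0 ≤ t) (hd : 0 ≤ d) (hb : b ^ 2 ≤ t * d) :
    (x + b) ^ 2 ≤ (1 + t) * (x ^ 2 + d) := by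
  rcases ht.eq_or_lt with rfl | ht
  · have : b = 0 := by nlinarith
    simp [this, hd]
  · have : 0 ≤ t * (t * x ^ 2 - 2 * x * b + d) := by nlinarith [sq_nonneg (t * x - b)]
    nlinarith [(mul_nonneg_iff_of_pos_left ht).1 this]

/-- The sequence `y₀, c (y₀ - y₁), -y₁, -c (y₁ - y₂), y₂, …`. For `c = 1 / (2 - α)` and `α < 2` the
entries at odd positions are those that minimise `branchForm α` when the entries at even positions
are prescribed. -/
def alternatingSeq (c : ℝ) : (ℕ → ℝ) →ₗ[ℝ] (ℕ → ℝ) where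
  toFun y j := (-1) ^ (j / 2) * if Even j then y (j / 2) else c * (y (j / 2) - y (j / 2 + 1))
  map_add' y z := by ext j; split_ifs with h <;> simp [h] <;> ring
  map_smul' a y := by ext j; split_ifs with h <;> simp [h] <;> ring

theorem alternatingSeq_two_mul (c : ℝ) (y : ℕ → ℝ) (j : ℕ) :
    alternatingSeq c y (2 * j) = (-1) ^ j * y j := by
  simp [alternatingSeq]

theorem alternatingSeq_two_mul_sq (c : ℝ) (y : ℕ → ℝ) (j : ℕ) :
    alternatingSeq c y (2 * j) ^ 2 = y j ^ 2 := by
  rw [alternatingSeq_two_mul, mul_pow, ← pow_mul, mul_comm j 2, (even_two_mul j).neg_one_pow,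
    one_mul]

theorem alternatingSeq_two_mul_add_one (c : ℝ) (y : ℕ → ℝ) (j : ℕ) :
    alternatingSeq c y (2 * j + 1) = (-1) ^ j * (c * (y j - y (j + 1))) := by
  have : (2 * j + 1) / 2 = j := by lia
  simp [alternatingSeq, this]

theorem sum_alternatingSeq_sq (c : ℝ) (y : ℕ → ℝ) (r : ℕ) :
    ∑ j ∈ range (2 * r), alternatingSeq c y j ^ 2 =
      ∑ j ∈ range r, y j ^ 2 + c ^ 2 * ∑ j ∈ range r, (y j - y (j + 1)) ^ 2 := by
  simp only [sum_range_two_mul, alternatingSeq_two_mul_sq, alternatingSeq_two_mul_add_one, mul_pow,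
    ← pow_mul, mul_comm _ 2, (even_two_mul _).neg_one_pow, one_mul, Finset.sum_add_distrib,
    Finset.mul_sum]

theorem sum_alternatingSeq_mul_succ (c : ℝ) (y : ℕ → ℝ) (r : ℕ) :
    ∑ j ∈ range (2 * r), alternatingSeq c y j * alternatingSeq c y (j + 1) =
      c * ∑ j ∈ range r, (y j - y (j + 1)) ^ 2 := by
  rw [sum_range_two_mul, Finset.mul_sum]
  refine Finset.sum_congr rfl fun j _ ↦ ?_
  have hsign : ((-1 : ℝ) ^ j) * (-1) ^ j = 1 := by rw [← mul_pow]; simp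
  rw [show 2 * j + 1 + 1 = 2 * (j + 1) by ring]
  simp only [alternatingSeq_two_mul, alternatingSeq_two_mul_add_one, pow_succ]
  linear_combination c * (y j - y (j + 1)) ^ 2 * hsign

theorem branchForm_congr {α : ℝ} {a : ℕ} {x z : ℕ → ℝ} (h : ∀ j ≤ a, x j = z j) :
    branchForm α a x = branchForm α a z := by
  rw [branchForm, branchForm]
  congr! 3 with j hj j hj
  · rw [h j (Finset.mem_range.1 hj).le, h (j + 1) (Finset.mem_range.1 hj)]
  · rw [h j (Finset.mem_range.1 hj).le]

theorem branchForm_alternatingSeq (α c : ℝ) (y : ℕ → ℝ) (r : ℕ) :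
    branchForm α (2 * r) (alternatingSeq c y) =
      (2 - α) * (∑ j ∈ range r, y j ^ 2 + c ^ 2 * ∑ j ∈ range r, (y j - y (j + 1)) ^ 2)
        - 2 * (c * ∑ j ∈ range r, (y j - y (j + 1)) ^ 2) - y 0 ^ 2 + y r ^ 2 := by
  have hzero : alternatingSeq c y 0 = y 0 := by simpa using alternatingSeq_two_mul c y 0
  rw [branchForm_eq, sum_alternatingSeq_sq, sum_alternatingSeq_mul_succ, hzero,
    alternatingSeq_two_mul_sq]

theorem branchForm_alternatingSeq_inv {ε : ℝ} (hε : ε ≠ 0) (y : ℕ → ℝ) (r : ℕ) :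
    branchForm (2 - ε) (2 * r) (alternatingSeq ε⁻¹ y) =
      ε * ∑ j ∈ range r, y j ^ 2 -
        (ε⁻¹ * ∑ j ∈ range r, (y j - y (j + 1)) ^ 2 + y 0 ^ 2) + y r ^ 2 := by
  rw [branchForm_alternatingSeq]
  field_simp
  ring

theorem mul_sum_sq_lt_of_apply_eq_zero {ε : ℝ} (hε : 0 < ε) {r : ℕ} (hr : ε * r < 1) {y : ℕ → ℝ}
    (hyr : y r = 0) (hy : 0 < ∑ j ∈ range r, y j ^ 2) :
    ε * ∑ j ∈ range r, y j ^ 2 < ε⁻¹ * ∑ j ∈ range r, (y j - y (j + 1)) ^ 2 + y 0 ^ 2 := by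
  set D := ∑ j ∈ range r, (y j - y (j + 1)) ^ 2
  have hpoint : ∀ j ∈ range r, y j ^ 2 ≤ r * D := fun j hj ↦ by
    simpa [hyr] using sq_sub_le_mul_sum_sq_sub y (Finset.mem_range.1 hj).le le_rfl
  have hsum : ∑ j ∈ range r, y j ^ 2 ≤ r * (r * D) := by
    simpa using Finset.sum_le_card_nsmul _ _ _ hpoint
  have hD : 0 < D := by
    by_contra! h
    nlinarith [mul_nonneg (Nat.cast_nonneg (α := ℝ) r) (Nat.cast_nonneg (α := ℝ) r)]
  calc ε * ∑ j ∈ range r, y j ^ 2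
      ≤ ε * (r * (r * D)) := by gcongr
    _ = ε⁻¹ * ((ε * r) ^ 2 * D) := by field_simp
    _ < ε⁻¹ * D := by
        gcongr
        exact mul_lt_of_lt_one_left hD (pow_lt_one₀ (by positivity) hr two_ne_zero)
    _ ≤ ε⁻¹ * D + y 0 ^ 2 := le_add_of_nonneg_right (sq_nonneg _)

theorem mul_sum_range_succ_sq_lt {ε : ℝ} (hε : 0 < ε) {r : ℕ} (hr : ε * (2 * r + 1) < 1)
    {y : ℕ → ℝ} (hy : 0 < ∑ j ∈ range (r + 1), y j ^ 2) :
    ε * ∑ j ∈ range (r + 1), y j ^ 2 <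
      ε⁻¹ * ∑ j ∈ range r, (y j - y (j + 1)) ^ 2 + y 0 ^ 2 := by
  set D := ∑ j ∈ range r, (y j - y (j + 1)) ^ 2
  set E := ε⁻¹ * D + y 0 ^ 2
  have hpoint : ∀ j ∈ range (r + 1), y j ^ 2 ≤ (1 + ε * r) * E := fun j hj ↦ by
    have hdist : (y j - y 0) ^ 2 ≤ ε * r * (ε⁻¹ * D) := by
      rw [sub_sq_comm]
      convert sq_sub_le_mul_sum_sq_sub y j.zero_le (Finset.mem_range_succ_iff.1 hj) using 1
      field_simp
      rfl
    have h := add_sq_le_of_sq_le_mul (x := y 0) (by positivity) (by positivity) hdist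
    rwa [add_sub_cancel, add_comm (y 0 ^ 2)] at h
  have hsum : ∑ j ∈ range (r + 1), y j ^ 2 ≤ (r + 1) * ((1 + ε * r) * E) := by
    simpa using Finset.sum_le_card_nsmul _ _ _ hpoint
  have hE : 0 < E := by
    by_contra! h
    have : 0 ≤ (r + 1) * (1 + ε * r) := by positivity
    nlinarith
  have hfactor : ε * ((r + 1) * (1 + ε * r)) < 1 := by
    have : 0 ≤ ε * r := by positivity
    nlinarith
  calc ε * ∑ j ∈ range (r + 1), y j ^ 2
      ≤ ε * ((r + 1) * ((1 + ε * r) * E)) := by gcongr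
    _ = ε * ((r + 1) * (1 + ε * r)) * E := by ring
    _ < E := mul_lt_of_lt_one_left hE hfactor

theorem branchForm_truncated_alternatingSeq_neg {ε : ℝ} (hε : 0 < ε) {a : ℕ} (ha : ε * a < 2)
    (hodd : Odd a → ε * a < 1) {y : ℕ → ℝ} (hsupp : ∀ j, (a + 1) / 2 ≤ j → y j = 0)
    (hy : y ≠ 0) :
    branchForm (2 - ε) a (fun j ↦ if j < a then alternatingSeq ε⁻¹ y j else 0) < 0 := by
  have hpos : 0 < ∑ j ∈ range ((a + 1) / 2), y j ^ 2 := by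
    obtain ⟨j, hj⟩ := Function.ne_iff.1 hy
    have hjr : j < (a + 1) / 2 := not_le.1 fun h ↦ hj (hsupp j h)
    have : y j ≠ 0 := hj
    exact Finset.sum_pos' (fun _ _ ↦ sq_nonneg _) ⟨j, Finset.mem_range.2 hjr, by positivity⟩
  obtain ⟨r, rfl | rfl⟩ := a.even_or_odd'
  · have hr : (2 * r + 1) / 2 = r := by lia
    rw [hr] at hpos hsupp
    have hyr := hsupp r le_rfl
    have hlt := mul_sum_sq_lt_of_apply_eq_zero hε (by push_cast at ha; linarith) hyr hpos
    rw [branchForm_congr (z := alternatingSeq ε⁻¹ y), branchForm_alternatingSeq_inv hε.ne', hyr]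
    · linarith
    · intro j hj
      rcases hj.lt_or_eq with hj | rfl
      · rw [if_pos hj]
      · rw [if_neg (lt_irrefl _), alternatingSeq_two_mul, hyr, mul_zero]
  · have hr : (2 * r + 1 + 1) / 2 = r + 1 := by lia
    rw [hr] at hpos
    have hlt := mul_sum_range_succ_sq_lt hε (by simpa using hodd ⟨r, rfl⟩) hpos
    rw [branchForm_succ_of_eq_zero _ (if_neg (lt_irrefl _)), if_pos (by lia),
      alternatingSeq_two_mul_sq, branchForm_congr fun j hj ↦ if_pos (by lia),
      branchForm_alternatingSeq_inv hε.ne']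
    rw [sum_range_succ] at hlt
    linarith

end Sequences

section Starlike

open SimpleGraph Function

variable {h : ℕ} {a : Fin h → ℕ}

/-- The neighbour of a branch vertex of a starlike tree on the way to the central vertex. -/
def starlikeParent (s : Σ i, Fin (a i)) : Option (Σ i, Fin (a i)) :=
  if hs : s.2 + 1 < a s.1 then some ⟨s.1, s.2 + 1, hs⟩ else none

theorem starlikeParent_eq_none {s : Σ i, Fin (a i)} :
    starlikeParent s = none ↔ s.2.val + 1 = a s.1 := by
  have := s.2.isLt
  rw [starlikeParent]
  split_ifs <;> simp <;> lia

theorem starlikeParent_eq_some {s t : Σ i, Fin (a i)} :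
    starlikeParent s = some t ↔ s.1 = t.1 ∧ s.2.val + 1 = t.2.val := by
  obtain ⟨i, s⟩ := s
  obtain ⟨j, t⟩ := t
  have := t.isLt
  rw [starlikeParent]
  constructor
  · split_ifs with hs
    · rintro ⟨⟩; exact ⟨rfl, rfl⟩
    · rintro ⟨⟩
  · rintro ⟨rfl : i = j, hst : s.val + 1 = t.val⟩
    simp [hst]

theorem starlikeGraph_adj_some_iff {s : Σ i, Fin (a i)} {q : Option (Σ i, Fin (a i))} :
    (starlikeGraph a).Adj (some s) q ↔
      starlikeParent s = q ∨ ∃ t, q = some t ∧ starlikeParent t = some s := by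
  cases q with
  | none => simp [starlikeGraph, starlikeParent_eq_none]
  | some t => simp [starlikeGraph, starlikeParent_eq_some, and_or_left, @eq_comm _ t.1]

theorem starlikeGraph_adj_parent (s : Σ i, Fin (a i)) :
    (starlikeGraph a).Adj (some s) (starlikeParent s) :=
  starlikeGraph_adj_some_iff.2 (.inl rfl)

theorem edge_starlikeParent_injective :
    Injective fun s : Σ i, Fin (a i) ↦ s(some s, starlikeParent s) := by
  intro s t hst
  rcases Sym2.eq_iff.1 hst with ⟨hst, -⟩ | ⟨hts, hst⟩
  · exact Option.some_injective _ hst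
  · have h₁ := starlikeParent_eq_some.1 hts.symm
    have h₂ := starlikeParent_eq_some.1 hst
    lia

theorem starlikeGraph_edgeSet :
    (starlikeGraph a).edgeSet = Set.range fun s ↦ s(some s, starlikeParent s) := by
  ext e
  refine ⟨fun he ↦ ?_, ?_⟩
  · induction e with | h p q
    match p, q, he with
    | some s, q, he =>
      rcases starlikeGraph_adj_some_iff.1 he with rfl | ⟨t, rfl, ht⟩
      · exact ⟨s, rfl⟩
      · exact ⟨t, by simpa only [ht] using Sym2.eq_swap⟩
    | none, some t, he => exact ⟨t, by simpa only [starlikeParent_eq_none.2 he] using Sym2.eq_swap⟩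
  · rintro ⟨s, rfl⟩
    exact starlikeGraph_adj_parent s

theorem ncard_edgeSet_starlikeGraph : (starlikeGraph a).edgeSet.ncard = ∑ i, a i := by
  rw [starlikeGraph_edgeSet, ← Set.image_univ,
    Set.ncard_image_of_injective _ edge_starlikeParent_injective, Set.ncard_univ,
    Nat.card_eq_fintype_card, Fintype.card_sigma]
  simp only [Fintype.card_fin]

theorem card_option_sigma_fin : Fintype.card (Option (Σ i, Fin (a i))) = ∑ i, a i + 1 := by
  simp

theorem avgDegree_starlikeGraph :
    avgDegree (starlikeGraph a) = 2 - 2 / (∑ i, a i + 1) := by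
  have : (0 : ℝ) < ∑ i, a i + 1 := by positivity
  rw [avgDegree_eq, ncard_edgeSet_starlikeGraph, card_option_sigma_fin]
  push_cast
  field_simp
  ring

theorem avgDegree_starlikeGraph_le_two : avgDegree (starlikeGraph a) ≤ 2 := by
  rw [avgDegree_starlikeGraph]
  exact sub_le_self 2 (by positivity)

theorem avgDegree_sup_edge_of_starlikeGraph_iso {V : Type*} [Fintype V] {G : SimpleGraph V}
    (ψ : starlikeGraph a ≃g G) {s t : V} (hadj : ¬G.Adj s t) (hne : s ≠ t) :
    avgDegree (G ⊔ edge s t) = 2 := by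
  have : (0 : ℝ) < ∑ i, a i + 1 := by positivity
  have hedges : (G ⊔ edge s t).edgeSet.ncard = ∑ i, a i + 1 := by
    rw [edgeSet_sup, edgeSet_edge_of_ne hne, Set.union_singleton,
      Set.ncard_insert_of_notMem (G.mem_edgeSet.not.2 hadj) G.edgeSet.toFinite,
      ← ncard_edgeSet_congr ψ, ncard_edgeSet_starlikeGraph]
  rw [avgDegree_eq, hedges, ← Fintype.card_congr ψ.toEquiv, card_option_sigma_fin]
  push_cast
  field_simp

/-- The entries of a vector on the starlike tree along the `i`-th branch, from the leaf to the
centre; the index `a i` gives the entry at the centre. -/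
def branchSeq (x : Option (Σ i, Fin (a i)) → ℝ) (i : Fin h) (j : ℕ) : ℝ :=
  if hj : j < a i then x (some ⟨i, j, hj⟩) else x none

theorem lapForm_starlikeGraph (α : ℝ) (x : Option (Σ i, Fin (a i)) → ℝ) :
    lapForm (starlikeGraph a) α x = ∑ i, branchForm α (a i) (branchSeq x i) - α * x none ^ 2 := by
  have hsome (s : Σ i, Fin (a i)) : x (some s) = branchSeq x s.1 s.2 := by simp [branchSeq]
  have hparent (s : Σ i, Fin (a i)) : x (starlikeParent s) = branchSeq x s.1 (s.2 + 1) := by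
    rw [starlikeParent, branchSeq]
    split_ifs <;> rfl
  rw [lapForm_eq_sum_of_edgeSet_eq_range edge_starlikeParent_injective starlikeGraph_edgeSet,
    Fintype.sum_option]
  simp only [hsome, hparent, Fintype.sum_sigma, branchForm, Finset.sum_sub_distrib,
    ← Finset.mul_sum, Finset.sum_range]
  ring

/-- The vertices at even distance from the leaf of their branch, indexed by half that distance. -/
def evenBranchVertex (s : Σ i, Fin ((a i + 1) / 2)) : Σ i, Fin (a i) :=
  ⟨s.1, 2 * s.2, by lia⟩

theorem evenBranchVertex_injective : Injective (evenBranchVertex (a := a)) := by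
  rintro ⟨i, s⟩ ⟨j, t⟩ hst
  obtain ⟨rfl, hst⟩ := Sigma.mk.inj hst
  simpa [Fin.ext_iff] using hst

/-- Pairing every even branch vertex with its parent matches each vertex at most once, because only
the odd branch pairs its last vertex with the centre. -/
theorem evenBranchVertex_parent_matching {l : Fin h} (heven : ∀ i ≠ l, Even (a i)) :
    Injective (Sum.elim (some ∘ evenBranchVertex (a := a))
      (starlikeParent ∘ evenBranchVertex)) := by
  have hodd (s : Σ i, Fin ((a i + 1) / 2)) (hs : starlikeParent (evenBranchVertex s) = none) :
      s.1 = l := by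
    by_contra hne
    obtain ⟨r, hr⟩ := heven _ hne
    have := starlikeParent_eq_none.1 hs
    simp only [evenBranchVertex] at this
    lia
  refine ((Option.some_injective _).comp evenBranchVertex_injective).sumElim ?_ ?_
  · rintro ⟨i, s⟩ ⟨j, t⟩ hst
    dsimp only [comp_apply] at hst
    cases hs : starlikeParent (evenBranchVertex ⟨i, s⟩) with
    | none =>
      obtain rfl : i = l := hodd _ hs
      obtain rfl : j = i := hodd _ (hst ▸ hs)
      have hs' := starlikeParent_eq_none.1 hs
      have ht' := starlikeParent_eq_none.1 (hst ▸ hs)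
      simp only [evenBranchVertex] at hs' ht'
      exact congrArg _ (Fin.ext (by lia))
    | some v =>
      obtain ⟨rfl, hs'⟩ := starlikeParent_eq_some.1 hs
      obtain ⟨rfl, ht'⟩ := starlikeParent_eq_some.1 (hst ▸ hs)
      simp only [evenBranchVertex] at hs' ht'
      exact congrArg _ (Fin.ext (by lia))
  · rintro s t hst
    have := (starlikeParent_eq_some.1 hst.symm).2
    simp only [evenBranchVertex] at this
    lia

theorem two_mul_sum_succ_div_two {l : Fin h} (heven : ∀ i ≠ l, Even (a i)) (hodd : Odd (a l)) :
    2 * ∑ i, (a i + 1) / 2 = ∑ i, a i + 1 := by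
  have hterm (i : Fin h) : 2 * ((a i + 1) / 2) = a i + if i = l then 1 else 0 := by
    split_ifs with hi
    · subst hi; obtain ⟨r, hr⟩ := hodd; lia
    · obtain ⟨r, hr⟩ := heven i hi; lia
  simp [Finset.mul_sum, hterm, Finset.sum_add_distrib]

/-- The sequence listing the entries of `y` on the `i`-th branch, followed by zeros. -/
noncomputable def zeroExtendBranch (m : Fin h → ℕ) (i : Fin h) :
    ((Σ i, Fin (m i)) → ℝ) →ₗ[ℝ] ℕ → ℝ :=
  ExtendByZero.linearMap ℝ Fin.val ∘ₗ LinearMap.funLeft ℝ ℝ (Sigma.mk (β := fun i ↦ Fin (m i)) i)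

theorem zeroExtendBranch_apply_val {m : Fin h → ℕ} (y : (Σ i, Fin (m i)) → ℝ) (i : Fin h)
    (j : Fin (m i)) : zeroExtendBranch m i y j = y ⟨i, j⟩ :=
  Fin.val_injective.extend_apply _ _ _

theorem zeroExtendBranch_eq_zero {m : Fin h → ℕ} (y : (Σ i, Fin (m i)) → ℝ) {i : Fin h} {j : ℕ}
    (hj : m i ≤ j) : zeroExtendBranch m i y j = 0 :=
  extend_apply' _ _ _ fun ⟨t, ht⟩ ↦ by lia

/-- The vector on the starlike tree which vanishes at the centre and is an alternating sequence with
prescribed even entries `y` on each branch. -/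
noncomputable def starlikeAlternating (c : ℝ) :
    ((Σ i, Fin ((a i + 1) / 2)) → ℝ) →ₗ[ℝ] Option (Σ i, Fin (a i)) → ℝ :=
  LinearMap.pi fun v ↦ v.elim 0 fun s ↦
    LinearMap.proj s.2.val ∘ₗ alternatingSeq c ∘ₗ zeroExtendBranch _ s.1

theorem branchSeq_starlikeAlternating (c : ℝ) (y : (Σ i, Fin ((a i + 1) / 2)) → ℝ) (i : Fin h) :
    branchSeq (starlikeAlternating c y) i =
      fun j ↦ if j < a i then alternatingSeq c (zeroExtendBranch _ i y) j else 0 := by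
  ext j
  rw [branchSeq]
  split_ifs <;> rfl

theorem sum_succ_div_two_le_sigNeg_lapForm {ε : ℝ} (hε : 0 < ε) (ha : ∀ i, ε * a i < 2)
    (hodd : ∀ i, Odd (a i) → ε * a i < 1) :
    ∑ i, (a i + 1) / 2 ≤ sigNeg (lapForm (starlikeGraph a) (2 - ε)) := by
  have hbranch (y : (Σ i, Fin ((a i + 1) / 2)) → ℝ) (i : Fin h)
      (hy : zeroExtendBranch _ i y ≠ 0) :
      branchForm (2 - ε) (a i) (branchSeq (starlikeAlternating ε⁻¹ y) i) < 0 := by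
    rw [branchSeq_starlikeAlternating]
    exact branchForm_truncated_alternatingSeq_neg hε (ha i) (hodd i)
      (fun j hj ↦ zeroExtendBranch_eq_zero y hj) hy
  have hbranch_zero (y : (Σ i, Fin ((a i + 1) / 2)) → ℝ) (i : Fin h)
      (hy : zeroExtendBranch _ i y = 0) :
      branchForm (2 - ε) (a i) (branchSeq (starlikeAlternating ε⁻¹ y) i) = 0 := by
    simp [branchSeq_starlikeAlternating, hy, branchForm]
  have hdim := finrank_le_sigNeg (Q := lapForm (starlikeGraph a) (2 - ε))
    (starlikeAlternating ε⁻¹) fun y hy ↦ by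
      obtain ⟨⟨i, j⟩, hij⟩ := Function.ne_iff.1 hy
      have hi : zeroExtendBranch _ i y ≠ 0 := fun h ↦ hij <| by
        rw [← zeroExtendBranch_apply_val y i j, h]; rfl
      have hcentre : starlikeAlternating ε⁻¹ y none = 0 := rfl
      rw [lapForm_starlikeGraph, hcentre, zero_pow two_ne_zero, mul_zero, sub_zero]
      refine Finset.sum_neg' (fun i _ ↦ ?_) ⟨i, Finset.mem_univ i, hbranch y i hi⟩
      by_cases hi : zeroExtendBranch _ i y = 0
      exacts [(hbranch_zero y i hi).le, (hbranch y i hi).le]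
  simpa using hdim

theorem sigNeg_lapForm_two_add_sum_succ_div_two_le {l : Fin h} (heven : ∀ i ≠ l, Even (a i))
    {V : Type*} [Fintype V] {G : SimpleGraph V} (f : starlikeGraph a →g G) (hf : Injective f) :
    sigNeg (lapForm G 2) + ∑ i, (a i + 1) / 2 ≤ Fintype.card V := by
  have hmatch := sigNeg_lapForm_two_add_card_le (G := G)
    (fun s ↦ f.map_adj (starlikeGraph_adj_parent (evenBranchVertex s)))
    (Sum.comp_elim f _ _ ▸ hf.comp (evenBranchVertex_parent_matching heven))
  simpa using hmatch

theorem sum_succ_div_two_le_sigNeg_lapForm_avgDegree {l : Fin h} (heven : ∀ i ≠ l, Even (a i))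
    (hl : 2 * a l < ∑ i, a i + 1) :
    ∑ i, (a i + 1) / 2 ≤ sigNeg (lapForm (starlikeGraph a) (avgDegree (starlikeGraph a))) := by
  have hn : (0 : ℝ) < ∑ i, a i + 1 := by positivity
  have hlong (i : Fin h) : 2 / (∑ i, a i + 1 : ℝ) * a i < 2 := by
    have hi : a i ≤ ∑ i, a i := Finset.single_le_sum_of_canonicallyOrdered (Finset.mem_univ i)
    rw [div_mul_eq_mul_div, div_lt_iff₀ hn]
    exact_mod_cast (by lia : 2 * a i < 2 * (∑ i, a i + 1))
  have hshort (i : Fin h) (hi : Odd (a i)) : 2 / (∑ i, a i + 1 : ℝ) * a i < 1 := by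
    obtain rfl : i = l := by
      by_contra hne
      exact Nat.not_even_iff_odd.2 hi (heven i hne)
    rw [div_mul_eq_mul_div, div_lt_iff₀ hn]
    exact_mod_cast (by lia : 2 * a i < 1 * (∑ i, a i + 1))
  rw [avgDegree_starlikeGraph]
  exact sum_succ_div_two_le_sigNeg_lapForm (div_pos two_pos hn) hlong hshort

theorem sum_succ_div_two_le_sigNeg_lapForm_two {l : Fin h} (heven : ∀ i ≠ l, Even (a i))
    (hl : 2 * a l < ∑ i, a i + 1) :
    ∑ i, (a i + 1) / 2 ≤ sigNeg (lapForm (starlikeGraph a) 2) :=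
  (sum_succ_div_two_le_sigNeg_lapForm_avgDegree heven hl).trans
    (sigNeg_lapForm_mono _ avgDegree_starlikeGraph_le_two)

theorem two_mul_sigmaG_starlikeGraph {l : Fin h} (heven : ∀ i ≠ l, Even (a i)) (hodd : Odd (a l))
    (hl : 2 * a l < ∑ i, a i + 1) : 2 * sigmaG (starlikeGraph a) = ∑ i, a i + 1 := by
  have hlower := sum_succ_div_two_le_sigNeg_lapForm_avgDegree heven hl
  have hupper := sigNeg_lapForm_two_add_sum_succ_div_two_le heven (Hom.id (G := starlikeGraph a))
    injective_id
  have hmono : sigNeg (lapForm (starlikeGraph a) (avgDegree (starlikeGraph a))) ≤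
      sigNeg (lapForm (starlikeGraph a) 2) :=
    sigNeg_lapForm_mono _ avgDegree_starlikeGraph_le_two
  have hcount := sigmaG_add_sigNeg_lapForm (starlikeGraph a)
  have hhalf := two_mul_sum_succ_div_two heven hodd
  rw [card_option_sigma_fin] at hcount hupper
  lia

end Starlike

section Path

open SimpleGraph Function
open Finset (range sum_range_succ)

theorem branchForm_alternatingSeq_add_two_mul_sq_neg {r : ℕ} {y : ℕ → ℝ}
    (hsupp : ∀ j, r ≤ j → y j = 0) (hy : y ≠ 0) :
    branchForm 2 (2 * r) (alternatingSeq r y) + 2 * y 0 ^ 2 < 0 := by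
  have hyr := hsupp r le_rfl
  have hform := branchForm_alternatingSeq 2 r y r
  set D := ∑ j ∈ range r, (y j - y (j + 1)) ^ 2
  have hpoint (j : ℕ) (hj : j ≤ r) : y j ^ 2 ≤ r * D := by
    simpa [hyr] using sq_sub_le_mul_sum_sq_sub y hj le_rfl
  obtain ⟨j, hj⟩ := Function.ne_iff.1 hy
  have hj_sq : 0 < y j ^ 2 := sq_pos_of_ne_zero hj
  have hj_le : j ≤ r := le_of_not_ge fun h ↦ hj (hsupp j h)
  rw [hform, hyr]
  linarith [hpoint 0 r.zero_le, hpoint j hj_le]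

theorem lapForm_pathGraph_succ (m : ℕ) (α : ℝ) (z : ℕ → ℝ) :
    lapForm (pathGraph (m + 1)) α (fun i ↦ z i) =
      ∑ j ∈ range m, (z j - z (j + 1)) ^ 2 - α * ∑ j ∈ range (m + 1), z j ^ 2 := by
  have hinj : Injective fun i : Fin m ↦ s(i.castSucc, i.succ) := by
    intro i j h
    rcases Sym2.eq_iff.1 h with ⟨h, -⟩ | ⟨h₁, h₂⟩
    · exact Fin.castSucc_injective m h
    · simp only [Fin.ext_iff, Fin.val_castSucc, Fin.val_succ] at h₁ h₂
      lia
  have hedges : (pathGraph (m + 1)).edgeSet = Set.range fun i : Fin m ↦ s(i.castSucc, i.succ) := by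
    ext e
    refine ⟨fun he ↦ ?_, ?_⟩
    · induction e with | h i j
      rcases pathGraph_adj.1 he with hij | hji
      · exact ⟨⟨i, by lia⟩, Sym2.eq_iff.2 (.inl ⟨rfl, Fin.ext hij⟩)⟩
      · exact ⟨⟨j, by lia⟩, Sym2.eq_iff.2 (.inr ⟨rfl, Fin.ext hji⟩)⟩
    · rintro ⟨i, rfl⟩
      exact pathGraph_adj.2 (.inl rfl)
  rw [lapForm_eq_sum_of_edgeSet_eq_range hinj hedges, Finset.sum_range, Finset.sum_range]
  rfl

theorem lapForm_pathGraph_add_canonVec {k : ℕ} (α : ℝ) {z : ℕ → ℝ} (hz : z k = 0) :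
    lapForm (pathGraph k) α (fun i ↦ z i) + ∑ i, (if canonVec k k i then z i ^ 2 else 0) =
      branchForm α k z := by
  cases k with
  | zero => simp [lapForm_apply, branchForm]
  | succ m =>
    have hlast (i : Fin (m + 1)) : canonVec (m + 1) (m + 1) i ↔ i = Fin.last m := by
      simp [canonVec, Fin.ext_iff]
    simp only [hlast, Finset.sum_ite_eq', Finset.mem_univ, if_true, lapForm_pathGraph_succ,
      branchForm, sum_range_succ, hz, Fin.val_last]
    ring

theorem sigNeg_lapForm_pathGraph_two_le (r : ℕ) : sigNeg (lapForm (pathGraph (2 * r)) 2) ≤ r := by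
  let p (j : Fin r) : Fin (2 * r) := ⟨2 * j, by lia⟩
  let q (j : Fin r) : Fin (2 * r) := ⟨2 * j + 1, by lia⟩
  have hinj : Injective (Sum.elim p q) := by
    rintro (i | i) (j | j) h <;> simp [p, q, Fin.ext_iff] at h ⊢ <;> lia
  have hmatch := sigNeg_lapForm_two_add_card_le (fun j ↦ pathGraph_adj.2 (.inl (by rfl))) hinj
  simp only [Fintype.card_fin] at hmatch
  lia

end Path

section JoinedCopies

open SimpleGraph

variable {k : ℕ} {U : Type*} (Gs : SimpleGraph (Fin k)) (B : SimpleGraph U) (u : U)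
  (y : Fin k → Bool)

/-- The automorphism of `G(G*, B, y)` which exchanges the two copies of `G*`. -/
def wGraphSwap : wGraph Gs B u y ≃g wGraph Gs B u y where
  toFun := Sum.elim (.inr ∘ .inl) (Sum.elim .inl (.inr ∘ .inr))
  invFun := Sum.elim (.inr ∘ .inl) (Sum.elim .inl (.inr ∘ .inr))
  left_inv := by rintro (i | i | t) <;> rfl
  right_inv := by rintro (i | i | t) <;> rfl
  map_rel_iff' := by rintro (i | i | t) (j | j | t') <;> rfl

variable (k U) in
/-- The decomposition of a vector on the vertices of `G(G*, B, y)` into a part which is symmetric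
under the exchange of the two copies of `G*` and an antisymmetric part. -/
noncomputable def symmAntisymm :
    (((Fin k → ℝ) × (U → ℝ)) × (Fin k → ℝ)) ≃ₗ[ℝ] (Fin k ⊕ Fin k ⊕ U → ℝ) where
  toFun x := Sum.elim (x.1.1 + x.2) (Sum.elim (x.1.1 - x.2) x.1.2)
  invFun x := ((fun i ↦ (x (.inl i) + x (.inr (.inl i))) / 2, fun t ↦ x (.inr (.inr t))),
    fun i ↦ (x (.inl i) - x (.inr (.inl i))) / 2)
  map_add' x z := by ext (i | i | t) <;> simp <;> ring
  map_smul' c x := by ext (i | i | t) <;> simp <;> ring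
  left_inv x := by ext i <;> simp
  right_inv x := by ext (i | i | t) <;> simp <;> ring

variable (k U) in
/-- The vector which agrees with `s` on the first copy of `G*`, with `-s` on the second copy, and
vanishes on the rest of `G(G*, B, y)`. -/
noncomputable def antisymmVec : (Fin k → ℝ) →ₗ[ℝ] Fin k ⊕ Fin k ⊕ U → ℝ :=
  (symmAntisymm k U).toLinearMap ∘ₗ LinearMap.inr ℝ _ _

theorem antisymmVec_apply (s : Fin k → ℝ) :
    antisymmVec k U s = Sum.elim s (Sum.elim (-s) 0) := by
  simp [antisymmVec, symmAntisymm]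

theorem symmAntisymm_neg_right (a : (Fin k → ℝ) × (U → ℝ)) (s : Fin k → ℝ) :
    symmAntisymm k U (a, -s) = symmAntisymm k U (a, s) ∘ wGraphSwap Gs B u y := by
  ext (i | i | t) <;> simp [symmAntisymm, wGraphSwap, sub_eq_add_neg]

variable {Gs B u y} in
/-- The operation `E_{e_1}` joins the two copies of the first vertex. -/
def supEdgeIsoOperationE {V : Type*} [NeZero k] {G : SimpleGraph V} (φ : wGraph Gs B u y ≃g G) :
    (wGraph Gs B u y ⊔ edge (.inl 0) (.inr (.inl 0))) ≃g operationE φ (canonVec k 1) where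
  toEquiv := φ.toEquiv
  map_rel_iff' := by
    intro p q
    have hfirst (i : Fin k) : canonVec k 1 i ↔ i = 0 := by
      simp only [canonVec, decide_eq_true_eq, Nat.add_eq_right, Fin.val_eq_zero_iff]
    change (operationE φ (canonVec k 1)).Adj (φ p) (φ q) ↔ _
    simp only [operationE, sup_adj, fromRel_adj, edge_adj, hfirst, exists_eq_left,
      φ.map_adj_iff, φ.injective.eq_iff, φ.injective.ne_iff]
    tauto

variable [Fintype U]

theorem lapForm_wGraph_antisymm (α : ℝ) (s : Fin k → ℝ) :
    lapForm (wGraph Gs B u y) α (antisymmVec k U s) =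
      2 * (lapForm Gs α s + ∑ i, if y i then s i ^ 2 else 0) := by
  classical
  have hsum (i : Fin k) :
      (∑ t, if y i ∧ t = u then s i ^ 2 else 0) = if y i then s i ^ 2 else 0 := by
    by_cases hi : y i <;> simp [hi]
  have hsum_comm : (∑ t, ∑ i, if y i ∧ t = u then s i ^ 2 else 0) =
      ∑ i, if y i then s i ^ 2 else 0 := by
    rw [Finset.sum_comm, Finset.sum_congr rfl fun i _ ↦ hsum i]
  have hcopy (i j : Fin k) : (-s i + s j) ^ 2 = (s i - s j) ^ 2 := by ring
  set H := wGraph Gs B u y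
  have hadj_left_left i j : H.Adj (.inl i) (.inl j) ↔ Gs.Adj i j := Iff.rfl
  have hadj_right_right i j : H.Adj (.inr (.inl i)) (.inr (.inl j)) ↔ Gs.Adj i j := Iff.rfl
  have hadj_left_right i j : ¬H.Adj (.inl i) (.inr (.inl j)) := id
  have hadj_right_left i j : ¬H.Adj (.inr (.inl i)) (.inl j) := id
  have hadj_left_root i t : H.Adj (.inl i) (.inr (.inr t)) ↔ y i ∧ t = u := Iff.rfl
  have hadj_root_left i t : H.Adj (.inr (.inr t)) (.inl i) ↔ y i ∧ t = u := Iff.rfl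
  have hadj_right_root i t : H.Adj (.inr (.inl i)) (.inr (.inr t)) ↔ y i ∧ t = u := Iff.rfl
  have hadj_root_right i t : H.Adj (.inr (.inr t)) (.inr (.inl i)) ↔ y i ∧ t = u := Iff.rfl
  simp only [antisymmVec_apply, lapForm_apply, Fintype.sum_sum_type, Sum.elim_inl, Sum.elim_inr,
    Pi.neg_apply, Pi.zero_apply, Finset.sum_add_distrib, sub_neg_eq_add, zero_sub, sub_zero,
    zero_add, neg_sq, zero_pow two_ne_zero, ite_self, Finset.sum_const_zero, if_false, hcopy, hsum,
    hsum_comm, hadj_left_left, hadj_right_right, hadj_left_right, hadj_right_left, hadj_left_root,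
    hadj_root_left, hadj_right_root, hadj_root_right]
  ring

theorem sigNeg_lapForm_wGraph_antisymm_le (α : ℝ) :
    sigNeg ((lapForm (wGraph Gs B u y) α).comp (antisymmVec k U)) ≤ sigNeg (lapForm Gs α) := by
  refine sigNeg_le_of_forall_neg fun s (hs : lapForm _ α (antisymmVec k U s) < 0) ↦ ?_
  rw [lapForm_wGraph_antisymm] at hs
  have hnonneg : 0 ≤ ∑ i, if y i then s i ^ 2 else 0 :=
    Finset.sum_nonneg fun i _ ↦ ite_nonneg (sq_nonneg _) le_rfl
  linarith

theorem lapForm_wGraph_sup_edge (α : ℝ) (x : Fin k ⊕ Fin k ⊕ U → ℝ) (i : Fin k) :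
    lapForm (wGraph Gs B u y ⊔ edge (.inl i) (.inr (.inl i))) α x =
      lapForm (wGraph Gs B u y) α x + (x (.inl i) - x (.inr (.inl i))) ^ 2 :=
  lapForm_sup_edge id Sum.inl_ne_inr α x

/-- Joining the two copies of a vertex does not change the form on symmetric vectors, so only the
antisymmetric parts have to be compared. -/
theorem sigNeg_lapForm_wGraph_le_sup_edge {α : ℝ} {i : Fin k}
    (h : sigNeg (lapForm Gs α) ≤ sigNeg ((lapForm (wGraph Gs B u y ⊔
      edge (.inl i) (.inr (.inl i))) α).comp (antisymmVec k U))) :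
    sigNeg (lapForm (wGraph Gs B u y) α) ≤
      sigNeg (lapForm (wGraph Gs B u y ⊔ edge (.inl i) (.inr (.inl i))) α) := by
  have hinv (a : (Fin k → ℝ) × (U → ℝ)) (s : Fin k → ℝ) :
      lapForm (wGraph Gs B u y) α (symmAntisymm k U (a, -s)) =
        lapForm (wGraph Gs B u y) α (symmAntisymm k U (a, s)) := by
    rw [symmAntisymm_neg_right Gs B u y, lapForm_comp_iso]
  refine sigNeg_le_sigNeg_of_map_neg_right (symmAntisymm k U) hinv (fun a s ↦ ?_) (fun a ↦ ?_)
    ((sigNeg_lapForm_wGraph_antisymm_le Gs B u y α).trans h)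
  · rw [lapForm_wGraph_sup_edge, lapForm_wGraph_sup_edge, hinv]
    simp only [symmAntisymm, LinearEquiv.coe_mk, LinearMap.coe_mk, AddHom.coe_mk, Sum.elim_inl,
      Sum.elim_inr, Pi.add_apply, Pi.sub_apply, Pi.neg_apply]
    ring
  · rw [lapForm_wGraph_sup_edge]
    simp [symmAntisymm]

end JoinedCopies

section JoinedLeaves

open SimpleGraph Function

variable {U : Type*} [Fintype U] (B : SimpleGraph U) (u : U)

theorem lapForm_wGraph_pathGraph_sup_edge_antisymm {k : ℕ} [NeZero k] (α : ℝ) {z : ℕ → ℝ}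
    (hz : z k = 0) :
    lapForm (wGraph (pathGraph k) B u (canonVec k k) ⊔ edge (.inl 0) (.inr (.inl 0))) α
        (antisymmVec k U fun i ↦ z i) = 2 * (branchForm α k z + 2 * z 0 ^ 2) := by
  rw [lapForm_wGraph_sup_edge, lapForm_wGraph_antisymm, lapForm_pathGraph_add_canonVec α hz,
    antisymmVec_apply]
  simp only [Sum.elim_inl, Sum.elim_inr, Pi.neg_apply, Fin.val_zero]
  ring

theorem le_sigNeg_lapForm_wGraph_pathGraph_sup_edge_antisymm {r : ℕ} [NeZero (2 * r)] :
    r ≤ sigNeg ((lapForm (wGraph (pathGraph (2 * r)) B u (canonVec (2 * r) (2 * r)) ⊔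
      edge (.inl 0) (.inr (.inl 0))) 2).comp (antisymmVec (2 * r) U)) := by
  let zeroExtend : (Fin r → ℝ) →ₗ[ℝ] ℕ → ℝ := ExtendByZero.linearMap ℝ Fin.val
  have hsupp (y : Fin r → ℝ) (j : ℕ) (hj : r ≤ j) : zeroExtend y j = 0 :=
    extend_apply' _ _ _ fun ⟨i, hi⟩ ↦ by lia
  have hval (y : Fin r → ℝ) (i : Fin r) : zeroExtend y i = y i :=
    Fin.val_injective.extend_apply _ _ _
  refine (Module.finrank_fin_fun ℝ).symm.trans_le <| finrank_le_sigNeg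
    (LinearMap.funLeft ℝ ℝ Fin.val ∘ₗ alternatingSeq r ∘ₗ zeroExtend) fun y hy ↦ ?_
  have hz : alternatingSeq r (zeroExtend y) (2 * r) = 0 := by
    rw [alternatingSeq_two_mul, hsupp y r le_rfl, mul_zero]
  have hz₀ : alternatingSeq r (zeroExtend y) 0 = zeroExtend y 0 := by
    simpa using alternatingSeq_two_mul r (zeroExtend y) 0
  have hneg := branchForm_alternatingSeq_add_two_mul_sq_neg (hsupp y) fun h ↦
    hy (funext fun i ↦ by rw [← hval y i, h]; rfl)
  have hform := lapForm_wGraph_pathGraph_sup_edge_antisymm B u 2 hz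
  rw [hz₀] at hform
  exact hform.trans_lt (mul_neg_of_pos_of_neg two_pos hneg)

theorem sigNeg_lapForm_wGraph_pathGraph_le_sup_edge {k : ℕ} [NeZero k] (hk : Even k) :
    sigNeg (lapForm (wGraph (pathGraph k) B u (canonVec k k)) 2) ≤
      sigNeg (lapForm (wGraph (pathGraph k) B u (canonVec k k) ⊔
        edge (.inl 0) (.inr (.inl 0))) 2) := by
  obtain ⟨r, rfl⟩ := even_iff_exists_two_mul.1 hk
  exact sigNeg_lapForm_wGraph_le_sup_edge _ B u _ ((sigNeg_lapForm_pathGraph_two_le r).trans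
    (le_sigNeg_lapForm_wGraph_pathGraph_sup_edge_antisymm B u))

theorem two_mul_sigmaG_wGraph_pathGraph_sup_edge {k : ℕ} [NeZero k] (hk : Even k)
    {h : ℕ} {a : Fin h → ℕ} {l : Fin h} (heven : ∀ i ≠ l, Even (a i)) (hodd : Odd (a l))
    (hl : 2 * a l < ∑ i, a i + 1)
    (ψ : starlikeGraph a ≃g wGraph (pathGraph k) B u (canonVec k k)) :
    2 * sigmaG (wGraph (pathGraph k) B u (canonVec k k) ⊔ edge (.inl 0) (.inr (.inl 0))) =
      ∑ i, a i + 1 := by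
  set H := wGraph (pathGraph k) B u (canonVec k k)
  have hupper := sigNeg_lapForm_two_add_sum_succ_div_two_le heven
    ((Hom.ofLE (le_sup_left (b := edge (.inl 0) (.inr (.inl 0))))).comp ψ.toHom) ψ.injective
  have hlower := sum_succ_div_two_le_sigNeg_lapForm_two heven hl
  have hjoin := sigNeg_lapForm_wGraph_pathGraph_le_sup_edge B u hk
  have hcount := sigmaG_add_sigNeg_lapForm (H ⊔ edge (.inl 0) (.inr (.inl 0)))
  have hhalf := two_mul_sum_succ_div_two heven hodd
  rw [avgDegree_sup_edge_of_starlikeGraph_iso ψ id Sum.inl_ne_inr] at hcount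
  rw [← Fintype.card_congr ψ.toEquiv, card_option_sigma_fin] at hcount hupper
  rw [sigNeg_lapForm_congr ψ] at hlower
  lia

end JoinedLeaves

theorem mainTheorem3 (n k : ℕ) {V : Type*} [Fintype V] (G : SimpleGraph V)
    (hG : FamilyS n k G) :
    (sigmaG G : ℝ) = n / 2 ∧
    ∀ {U : Type*} (B : SimpleGraph U) (u : U)
      (φ : wGraph (SimpleGraph.pathGraph k) B u (canonVec k k) ≃g G),
      (sigmaG (operationE φ (canonVec k 1)) : ℝ) = n / 2 := by
  obtain ⟨hcard, hk, m, a, rfl, -, -, heven, hodd, hlast, ⟨ψ⟩⟩ := hG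
  have hsum : ∑ i, a i + 1 = n := by
    rw [← hcard, Nat.card_eq_fintype_card, ← Fintype.card_congr ψ.toEquiv, card_option_sigma_fin]
  have hl : 2 * a (Fin.last (m + 2)) < ∑ i, a i + 1 := by
    rw [hsum]
    exact_mod_cast (lt_div_iff₀' two_pos).1 hlast
  have hhalf {s : ℕ} (hs : 2 * s = ∑ i, a i + 1) : (s : ℝ) = n / 2 := by
    rw [eq_div_iff two_ne_zero, mul_comm]
    exact_mod_cast hs.trans hsum
  refine ⟨hhalf ?_, fun {U} B u φ ↦ hhalf ?_⟩
  · rw [← sigmaG_congr ψ]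
    exact two_mul_sigmaG_starlikeGraph heven hodd hl
  · have : NeZero (a 0) := ⟨by lia⟩
    have : Finite U := .of_injective (φ ∘ .inr ∘ .inr)
      (φ.injective.comp (Sum.inr_injective.comp Sum.inr_injective))
    have := Fintype.ofFinite U
    rw [← sigmaG_congr (supEdgeIsoOperationE φ)]
    exact two_mul_sigmaG_wGraph_pathGraph_sup_edge B u (heven 0 Fin.last_pos.ne) heven hodd hl
      (ψ.trans φ.symm)
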